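/- For $A \subseteq \mathbb{R}^d$ let the flat-dimension $dm(A)$ be the largest integer $k \ge -1$ such that $A$ includes a $k$-simplex, i.e. the convex hull of $k+1$ affinely independent points (so $dm(\emptyset)=-1$), and for $p \in A$ let the local dimension be $dm(A,p)=\min_{\epsilon>0} dm(A\cap B(p,\epsilon))$, where $B(p,\epsilon)$ is the open ball. A $k$-flat is a nonempty affine subspace of $\mathbb{R}^d$ of dimension $k$, and a flat is a $k$-flat for some $k$. A flat $H$ is an ordinary flat of $A$ if there are $0\le k\le d$, a point $p\in A$ with $dm(A,p)=k$ and an open neighborhood $U$ of $p$ such that $H$ is a $k$-flat and $A\cap U=H\cap U$. A strong cover of $A$ is a finite collection $\mathcal{C}$ of flats such that each $p\in A$ belongs to some flat in $\mathcal{C}$ of dimension $dm(A,p)$, and such that no proper subcollection of $\mathcal{C}$ has this property. **Theorem.** For all $n,d\in\mathbb{N}$ there is a number $g=g(n,d)$ such that the following holds. Let $K_1,\dots,K_n\subseteq\mathbb{R}^d$ be convex sets and let $S=\mathbb{R}^d\setminus\bigcup_{i=1}^n K_i$. Then $S$ can be covered by at most $g$ flats in such a way that each $p\in S$ belongs to one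 of these flats of dimension $dm(S,p)$. Furthermore, $S$ admits a unique strong cover, namely the collection of all ordinary flats of $S$; this collection is finite and has at most $g$ members. -/

import Mathlib

namespace FlatCover

/-- `S` includes a `k`-simplex, i.e. the convex hull of `k + 1` affinely independent points.
Here `k` is an integer; necessarily `k ≥ -1`, and the `(-1)`-simplex is the empty set. -/
def IncludesSimplex {d : ℕ} (S : Set (EuclideanSpace ℝ (Fin d))) (k : ℤ) : Prop :=
  ∃ (m : ℕ) (v : Fin m → EuclideanSpace ℝ (Fin d)),
    (m : ℤ) = k + 1 ∧ AffineIndependent ℝ v ∧ convexHull ℝ (Set.range v) ⊆ S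

/-- The flat-dimension `dm(S)`: the largest `k` such that `S` includes a `k`-simplex
(the maximum exists, see `isGreatest_flatDim`). In particular `dm(∅) = -1`. -/
noncomputable def flatDim {d : ℕ} (S : Set (EuclideanSpace ℝ (Fin d))) : ℤ :=
  sSup {k : ℤ | IncludesSimplex S k}

/-- The local dimension `dm(S, p)`: the minimum over `ε > 0` of `dm(S ∩ B(p, ε))`
(the minimum exists, see `isLeast_localDim`). -/
noncomputable def localDim {d : ℕ} (S : Set (EuclideanSpace ℝ (Fin d)))
    (p : EuclideanSpace ℝ (Fin d)) : ℤ :=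
  sInf {k : ℤ | ∃ ε : ℝ, 0 < ε ∧ k = flatDim (S ∩ Metric.ball p ε)}

theorem isGreatest_flatDim {d : ℕ} (S : Set (EuclideanSpace ℝ (Fin d))) :
    IsGreatest {k : ℤ | IncludesSimplex S k} (flatDim S) := by
  have hne : {k : ℤ | IncludesSimplex S k}.Nonempty := by
    refine ⟨-1, 0, Fin.elim0, by norm_num, affineIndependent_of_subsingleton ℝ _, ?_⟩
    simp
  have hb : BddAbove {k : ℤ | IncludesSimplex S k} := by
    refine ⟨d, ?_⟩
    rintro k ⟨m, v, hm, hv, -⟩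
    have h1 := hv.card_le_finrank_succ
    have h2 := Submodule.finrank_le (vectorSpan ℝ (Set.range v))
    simp only [Fintype.card_fin, finrank_euclideanSpace] at h1 h2
    lia
  exact ⟨Int.csSup_mem hne hb, fun k hk => le_csSup hb hk⟩

theorem isLeast_localDim {d : ℕ} (S : Set (EuclideanSpace ℝ (Fin d)))
    (p : EuclideanSpace ℝ (Fin d)) :
    IsLeast {k : ℤ | ∃ ε : ℝ, 0 < ε ∧ k = flatDim (S ∩ Metric.ball p ε)} (localDim S p) := by
  have hne : {k : ℤ | ∃ ε : ℝ, 0 < ε ∧ k = flatDim (S ∩ Metric.ball p ε)}.Nonempty :=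
    ⟨_, 1, one_pos, rfl⟩
  have hb : BddBelow {k : ℤ | ∃ ε : ℝ, 0 < ε ∧ k = flatDim (S ∩ Metric.ball p ε)} := by
    refine ⟨-1, ?_⟩
    rintro k ⟨ε, -, rfl⟩
    obtain ⟨m, -, hm, -⟩ := (isGreatest_flatDim (S ∩ Metric.ball p ε)).1
    have h0 : (0 : ℤ) ≤ m := Int.natCast_nonneg m
    rw [hm] at h0
    linarith
  exact ⟨Int.csInf_mem hne hb, fun k hk => csInf_le hb hk⟩

/-- `H` is a `k`-flat: a nonempty affine subspace of dimension `k`. -/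
def IsFlatOfDim {d : ℕ} (k : ℤ) (H : AffineSubspace ℝ (EuclideanSpace ℝ (Fin d))) : Prop :=
  (H : Set (EuclideanSpace ℝ (Fin d))).Nonempty ∧ (Module.finrank ℝ H.direction : ℤ) = k

/-- `p` is a `k`-ordinary point of `S`, and `H` is a corresponding `k`-flat. -/
def IsOrdinaryAt {d : ℕ} (S : Set (EuclideanSpace ℝ (Fin d))) (k : ℤ)
    (p : EuclideanSpace ℝ (Fin d)) (H : AffineSubspace ℝ (EuclideanSpace ℝ (Fin d))) : Prop :=
  p ∈ S ∧ localDim S p = k ∧ IsFlatOfDim k H ∧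
    ∃ U : Set (EuclideanSpace ℝ (Fin d)), IsOpen U ∧ p ∈ U ∧
      S ∩ U = (H : Set (EuclideanSpace ℝ (Fin d))) ∩ U

/-- The collection of all ordinary flats of `S`. -/
def ordinaryFlats {d : ℕ} (S : Set (EuclideanSpace ℝ (Fin d))) :
    Set (AffineSubspace ℝ (EuclideanSpace ℝ (Fin d))) :=
  {H | ∃ k : ℤ, 0 ≤ k ∧ k ≤ d ∧ ∃ p, IsOrdinaryAt S k p H}

/-- `C` is a collection of flats (nonempty affine subspaces), and every point `p` of `S` belongs
to some member of `C` of dimension `dm(S, p)`. -/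
def IsLocalDimCover {d : ℕ} (S : Set (EuclideanSpace ℝ (Fin d)))
    (C : Set (AffineSubspace ℝ (EuclideanSpace ℝ (Fin d)))) : Prop :=
  (∀ H ∈ C, (H : Set (EuclideanSpace ℝ (Fin d))).Nonempty) ∧
    ∀ p ∈ S, ∃ H ∈ C, p ∈ H ∧ IsFlatOfDim (localDim S p) H

/-- `C` is a strong cover of `S`: a finite collection of flats such that every `p ∈ S` belongs to
a member of dimension `dm(S, p)`, and such that no proper subcollection has this property. -/
def IsStrongCover {d : ℕ} (S : Set (EuclideanSpace ℝ (Fin d)))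
    (C : Set (AffineSubspace ℝ (EuclideanSpace ℝ (Fin d)))) : Prop :=
  C.Finite ∧ IsLocalDimCover S C ∧ ∀ C' : Set _, C' ⊂ C → ¬ IsLocalDimCover S C'

end FlatCover

/-! Where `S` has arbitrarily small full-dimensional simplices, the whole space serves. Near any
other `p ∈ S`, the closures of the `K i` with interior cover a neighbourhood. Sort such points by
which of these closures contain them. If `p`, `q` are in one class, a point slightly beyond `p` on
the ray from `q` lies in some closure containing both; a functional supporting `K i` at `p` is then
constant along the line, so `q` lies on the supporting hyperplane. Hence at most `n` hyperplanes
carry each class (`exists_proper_flats`), and induction on dimension inside them gives boundedly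
many flats of at most the local dimension, which are then enlarged.

For uniqueness, a finite cover cannot omit an ordinary flat `H`, since finitely many proper
subspaces do not fill an open part of `H`. Conversely, a member of a minimal cover has a point that
only it serves; at a generic point of a small maximal simplex nearby, `S` coincides with that member
(`mem_ordinaryFlats_of_unique`). -/

namespace FlatCover

open Set Module Topology

/-! ### General position -/

section Torsor

variable {V P : Type*} [NormedAddCommGroup V] [NormedSpace ℝ V] [FiniteDimensional ℝ V]
  [MetricSpace P] [NormedAddTorsor V P]

/-- Finitely many proper affine subspaces do not cover a nonempty open set. -/
theorem exists_mem_forall_notMem_of_ne_top {C : Set (AffineSubspace ℝ P)} (hC : C.Finite)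
    (htop : ∀ H ∈ C, H ≠ ⊤) {O : Set P} (hO : IsOpen O) (hne : O.Nonempty) :
    ∃ x ∈ O, ∀ H ∈ C, x ∉ H := by
  induction C, hC using Set.Finite.induction_on generalizing O with
  | empty => exact ⟨hne.some, hne.some_mem, by simp⟩
  | @insert H C _ _ ih =>
    have hH : (O \ (H : Set P)).Nonempty := by
      by_contra h
      rw [not_nonempty_iff_eq_empty, sdiff_eq_empty] at h
      refine htop H (mem_insert _ _) (top_unique ?_)
      rw [← hO.affineSpan_eq_top hne]
      exact affineSpan_le.2 h
    obtain ⟨x, hx, hxC⟩ := ih (fun H' h' => htop H' (mem_insert_of_mem _ h'))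
      (hO.sdiff (H.closed_of_finiteDimensional)) hH
    exact ⟨x, hx.1, by rintro H' (rfl | h'); exacts [hx.2, hxC H' h']⟩

end Torsor

/-! ### Small simplices and supporting hyperplanes -/

variable {V : Type*} [NormedAddCommGroup V] [NormedSpace ℝ V]

/-- Every neighbourhood of `p` contains a `k`-simplex that is included in `S`. -/
def HasSmallSimplices (S : Set V) (p : V) (k : ℕ) : Prop :=
  ∀ U ∈ 𝓝 p, ∃ v : Fin (k + 1) → V,
    AffineIndependent ℝ v ∧ convexHull ℝ (range v) ⊆ S ∩ U

theorem HasSmallSimplices.map {W : Type*} [NormedAddCommGroup W] [NormedSpace ℝ W]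
    {S : Set V} {φ : W →ᵃ[ℝ] V} (hφ : Function.Injective φ) (hc : Continuous φ) {w : W} {k : ℕ}
    (h : HasSmallSimplices (φ ⁻¹' S) w k) : HasSmallSimplices S (φ w) k := by
  intro U hU
  obtain ⟨v, hv, hvS⟩ := h (φ ⁻¹' U) (hc.continuousAt.preimage_mem_nhds hU)
  refine ⟨φ ∘ v, hv.map' φ hφ, ?_⟩
  rw [range_comp, ← φ.image_convexHull]
  rintro _ ⟨x, hx, rfl⟩
  exact hvS hx

/-- A nonempty open set includes a simplex of full dimension. -/
theorem exists_simplex_subset_of_isOpen [FiniteDimensional ℝ V] {O : Set V} (hO : IsOpen O)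
    (hne : O.Nonempty) :
    ∃ v : Fin (finrank ℝ V + 1) → V, AffineIndependent ℝ v ∧ convexHull ℝ (range v) ⊆ O := by
  obtain ⟨p, hp⟩ := hne
  obtain ⟨ε, hε, hball⟩ := Metric.isOpen_iff.1 hO p hp
  obtain ⟨t, ht, hts, hti⟩ := exists_affineIndependent ℝ V (Metric.ball p ε)
  rw [Metric.isOpen_ball.affineSpan_eq_top ⟨p, Metric.mem_ball_self hε⟩] at hts
  have : Fintype t := (finite_set_of_fin_dim_affineIndependent ℝ hti).fintype
  have hcard := hti.affineSpan_eq_top_iff_card_eq_finrank_add_one.1 (by simpa using hts)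
  let e := Fintype.equivFinOfCardEq hcard
  refine ⟨fun i => (e.symm i : V), hti.comp_embedding e.symm.toEmbedding, ?_⟩
  refine (convexHull_min ?_ (convex_ball p ε)).trans hball
  rintro _ ⟨i, rfl⟩
  exact ht (e.symm i).2

theorem hasSmallSimplices_of_mem_nhds [FiniteDimensional ℝ V] {S : Set V} {p : V} (h : S ∈ 𝓝 p) :
    HasSmallSimplices S p (finrank ℝ V) := by
  intro U hU
  obtain ⟨O, hOs, hO, hp⟩ := mem_nhds_iff.1 (Filter.inter_mem h hU)
  obtain ⟨v, hv, hvO⟩ := exists_simplex_subset_of_isOpen hO ⟨p, hp⟩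
  exact ⟨v, hv, hvO.trans hOs⟩

/-- If the complement `S` of finitely many convex sets has no small full-dimensional simplices
at `p`, then near `p` the space is covered by the closures of the convex sets with interior
points. -/
theorem exists_nhds_subset_iUnion_closure [FiniteDimensional ℝ V] {ι : Type*} [Finite ι]
    {K : ι → Set V} (hK : ∀ i, Convex ℝ (K i)) {p : V}
    (hp : ¬ HasSmallSimplices (⋃ i, K i)ᶜ p (finrank ℝ V)) :
    ∃ U ∈ 𝓝 p, ∀ x ∈ U, ∃ i, (interior (K i)).Nonempty ∧ x ∈ closure (K i) := by
  simp only [HasSmallSimplices] at hp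
  push Not at hp
  obtain ⟨U, hU, hno⟩ := hp
  refine ⟨interior U, interior_mem_nhds.2 hU, ?_⟩
  by_contra! hcon
  obtain ⟨x, hxU, hx⟩ := hcon
  -- The sets without interior have proper affine spans, so deleting these from `O` leaves room for
  -- a forbidden simplex.
  let O : Set V := interior U ∩ ⋂ i : {i // (interior (K i)).Nonempty}, (closure (K i))ᶜ
  have hO : IsOpen O := isOpen_interior.inter
    (isOpen_iInter_of_finite fun i => isClosed_closure.isOpen_compl)
  have hOne : O.Nonempty := ⟨x, hxU, by simpa using hx⟩
  let C : Set (AffineSubspace ℝ V) :=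
    (fun i => affineSpan ℝ (K i)) '' {i | ¬ (interior (K i)).Nonempty}
  have hC : C.Finite := (toFinite _).image _
  have hCtop : ∀ H ∈ C, H ≠ ⊤ := by
    rintro _ ⟨i, hi, rfl⟩ h
    exact hi ((hK i).interior_nonempty_iff_affineSpan_eq_top.2 h)
  obtain ⟨y, hyO, hyC⟩ := exists_mem_forall_notMem_of_ne_top hC hCtop hO hOne
  let O' : Set V := O \ ⋃ H ∈ C, (H : Set V)
  have hO' : IsOpen O' := hO.sdiff
    (hC.isClosed_biUnion fun H _ => H.closed_of_finiteDimensional)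
  obtain ⟨v, hv, hvO⟩ := exists_simplex_subset_of_isOpen hO' ⟨y, hyO, by simpa using hyC⟩
  refine hno v hv (hvO.trans fun z hz => ⟨?_, interior_subset hz.1.1⟩)
  simp only [mem_compl_iff, mem_iUnion, not_exists]
  intro i hzi
  by_cases hi : (interior (K i)).Nonempty
  · exact mem_iInter.1 hz.1.2 ⟨i, hi⟩ (subset_closure hzi)
  · exact hz.2 (mem_biUnion (mem_image_of_mem _ hi) (subset_affineSpan ℝ _ hzi))

/-- A point outside a convex set with interior points admits a supporting functional. -/
theorem exists_supporting_functional {K : Set V} (hK : Convex ℝ K)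
    (hint : (interior K).Nonempty) {p : V} (hp : p ∉ K) :
    ∃ f : V →L[ℝ] ℝ, f ≠ 0 ∧ ∀ x ∈ closure K, f p ≤ f x := by
  obtain ⟨f, hf⟩ := geometric_hahn_banach_point_open hK.interior isOpen_interior
    (fun h => hp (interior_subset h))
  refine ⟨f, ?_, ?_⟩
  · rintro rfl
    simpa using hf _ hint.some_mem
  · rw [← hK.closure_interior_eq_closure_of_nonempty_interior hint]
    exact fun x hx => closure_minimal (t := {x | f p ≤ f x}) (fun y hy => (hf y hy).le)
      (isClosed_le continuous_const f.continuous) hx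

/-- The points of the complement of `n` convex sets without small full-dimensional simplices lie
on boundedly many proper flats. -/
theorem exists_proper_flats [FiniteDimensional ℝ V] {n : ℕ} {K : Fin n → Set V}
    (hK : ∀ i, Convex ℝ (K i)) :
    ∃ h : Set (Fin n) × Fin n → AffineSubspace ℝ V, ∀ p ∈ (⋃ i, K i)ᶜ,
      ¬ HasSmallSimplices (⋃ i, K i)ᶜ p (finrank ℝ V) →
        ∃ x, p ∈ h x ∧ finrank ℝ (h x).direction < finrank ℝ V := by
  let J : V → Set (Fin n) := fun p => {i | (interior (K i)).Nonempty ∧ p ∈ closure (K i)}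
  suffices H : ∀ I : Set (Fin n), ∃ h : Fin n → AffineSubspace ℝ V, ∀ p ∈ (⋃ i, K i)ᶜ,
      ¬ HasSmallSimplices (⋃ i, K i)ᶜ p (finrank ℝ V) → J p = I →
        ∃ i, p ∈ h i ∧ finrank ℝ (h i).direction < finrank ℝ V by
    choose h hh using H
    exact ⟨fun x => h x.1 x.2, fun p hp hps =>
      let ⟨i, hi⟩ := hh (J p) p hp hps rfl; ⟨(J p, i), hi⟩⟩
  intro I
  by_cases hI : ∃ p ∈ (⋃ i, K i)ᶜ,
    ¬ HasSmallSimplices (⋃ i, K i)ᶜ p (finrank ℝ V) ∧ J p = I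
  swap
  · exact ⟨fun _ => ⊤, fun p hp hps hpI => absurd ⟨p, hp, hps, hpI⟩ hI⟩
  obtain ⟨p, hp, hps, rfl⟩ := hI
  have hf : ∀ i, ∃ f : V →L[ℝ] ℝ, (interior (K i)).Nonempty →
      f ≠ 0 ∧ ∀ x ∈ closure (K i), f p ≤ f x := by
    intro i
    by_cases hi : (interior (K i)).Nonempty
    · obtain ⟨f, hf⟩ := exists_supporting_functional (hK i) hi (fun h => hp (mem_iUnion_of_mem i h))
      exact ⟨f, fun _ => hf⟩
    · exact ⟨0, fun h => absurd h hi⟩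
  choose f hf using hf
  -- One representative `p` fixes the hyperplanes for its whole class.
  refine ⟨fun i => AffineSubspace.mk' p (LinearMap.ker (f i : V →ₗ[ℝ] ℝ)), fun q hq _ hqp => ?_⟩
  obtain ⟨U, hU, hUc⟩ := exists_nhds_subset_iUnion_closure hK hps
  have hnear : ∀ᶠ x in 𝓝 p, x ∈ U ∧ ∀ i, p ∉ closure (K i) → x ∉ closure (K i) := by
    refine Filter.Eventually.and hU (Filter.eventually_all.2 fun i => ?_)
    by_cases hi : p ∈ closure (K i)
    · simp [hi]
    · filter_upwards [isClosed_closure.isOpen_compl.mem_nhds hi] with x hx _ using hx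
  have hcont : Filter.Tendsto (fun t : ℝ => p - t • (q - p)) (𝓝[>] 0) (𝓝 p) := by
    have : Continuous fun t : ℝ => p - t • (q - p) := by fun_prop
    simpa using (this.tendsto 0).mono_left nhdsWithin_le_nhds
  obtain ⟨t, ⟨htU, htK⟩, ht⟩ := ((hcont.eventually hnear).and self_mem_nhdsWithin).exists
  obtain ⟨i, hi, hti⟩ := hUc _ htU
  have hpi : i ∈ J p := ⟨hi, by_contra fun h => htK i h hti⟩
  have hqi : i ∈ J q := hqp ▸ hpi
  have h1 := (hf i hi).2 _ hti
  have h2 := (hf i hi).2 _ hqi.2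
  have ht0 : 0 < t := ht
  rw [map_sub, map_smul, map_sub, smul_eq_mul] at h1
  -- `p` lies strictly between `q` and `p - t • (q - p)`, and `f i` is at least `f i p` at both.
  have h3 : f i q = f i p := by nlinarith
  refine ⟨i, ?_, ?_⟩
  · simp [AffineSubspace.mem_mk', h3]
  · rw [AffineSubspace.direction_mk']
    refine Submodule.finrank_lt fun h => (hf i hi).1 ?_
    ext x
    exact LinearMap.congr_fun (LinearMap.ker_eq_top.1 h) x

/-- The complement of `n` convex sets in a space of dimension `m` is covered by at most `g n m`
flats, each of its points being in a flat of at most its local dimension. -/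
theorem exists_flats_hasSmallSimplices (n m : ℕ) :
    ∃ g : ℕ, ∀ (V : Type) [NormedAddCommGroup V] [NormedSpace ℝ V] [FiniteDimensional ℝ V],
      finrank ℝ V ≤ m → ∀ K : Fin n → Set V, (∀ i, Convex ℝ (K i)) →
        ∃ C : Finset (AffineSubspace ℝ V), C.card ≤ g ∧ ∀ p ∈ (⋃ i, K i)ᶜ,
          ∃ H ∈ C, p ∈ H ∧ HasSmallSimplices (⋃ i, K i)ᶜ p (finrank ℝ H.direction) := by
  classical
  induction m with
  | zero =>
    refine ⟨1, fun V _ _ _ hV K _ => ⟨{⊤}, by simp, fun p hp => ⟨⊤, by simp, trivial, ?_⟩⟩⟩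
    have : Subsingleton V := finrank_zero_iff.1 (Nat.le_zero.1 hV)
    rw [AffineSubspace.direction_top, finrank_top]
    refine hasSmallSimplices_of_mem_nhds ?_
    rw [Subsingleton.eq_univ_of_nonempty ⟨p, hp⟩]
    exact Filter.univ_mem
  | succ m ih =>
    obtain ⟨g, hg⟩ := ih
    -- One for `⊤`, and `g` for each flat from `exists_proper_flats`.
    refine ⟨1 + Fintype.card (Set (Fin n) × Fin n) * g, fun V _ _ _ hV K hK => ?_⟩
    obtain ⟨h, hh⟩ := exists_proper_flats hK
    have key : ∀ x, ∃ C : Finset (AffineSubspace ℝ V), C.card ≤ g ∧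
        (finrank ℝ (h x).direction < finrank ℝ V → ∀ p ∈ (⋃ i, K i)ᶜ, p ∈ h x →
          ∃ H ∈ C, p ∈ H ∧ HasSmallSimplices (⋃ i, K i)ᶜ p (finrank ℝ H.direction)) := by
      intro x
      by_cases hx : finrank ℝ (h x).direction < finrank ℝ V ∧ (h x : Set V).Nonempty
      swap
      · exact ⟨∅, by simp, fun hlt p _ hp => absurd ⟨hlt, p, hp⟩ hx⟩
      obtain ⟨hlt, q, hq⟩ := hx
      -- Translation by `q` identifies the flat with a vector space of smaller dimension, where the
      -- traces of the `K i` remain convex.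
      let φ : (h x).direction →ᵃ[ℝ] V :=
        (h x).direction.subtype.toAffineMap + AffineMap.const ℝ _ q
      have hφ : ∀ w, φ w = (w : V) + q := fun w => rfl
      have hφi : Function.Injective φ := fun a b hab => by simpa [hφ] using hab
      have hφc : Continuous φ := by
        have : Continuous fun w : (h x).direction => (w : V) + q := by fun_prop
        exact this
      obtain ⟨C, hC, hCp⟩ := hg (h x).direction (by lia) (fun i => φ ⁻¹' K i)
        (fun i => (hK i).affine_preimage φ)
      refine ⟨C.image (AffineSubspace.map φ), Finset.card_image_le.trans hC, fun _ p hp hpx => ?_⟩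
      have hpφ : φ ⟨p - q, AffineSubspace.vsub_mem_direction hpx hq⟩ = p := by simp [hφ]
      have hpre : (⋃ i, φ ⁻¹' K i)ᶜ = φ ⁻¹' (⋃ i, K i)ᶜ := by
        rw [preimage_compl, preimage_iUnion]
      obtain ⟨H, hHC, hpH, hH⟩ := hCp ⟨p - q, AffineSubspace.vsub_mem_direction hpx hq⟩
        (by rw [hpre, mem_preimage, hpφ]; exact hp)
      refine ⟨H.map φ, Finset.mem_image_of_mem _ hHC, ⟨_, hpH, hpφ⟩, ?_⟩
      rw [hpre] at hH
      have hmap := hH.map hφi hφc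
      rw [hpφ] at hmap
      rwa [AffineSubspace.map_direction, ← (Submodule.equivMapOfInjective φ.linear
        (φ.linear_injective_iff.2 hφi) H.direction).finrank_eq]
    choose C hCg hC using key
    refine ⟨{⊤} ∪ Finset.univ.biUnion C, ?_, fun p hp => ?_⟩
    · refine (Finset.card_union_le _ _).trans ?_
      gcongr
      · simp
      · exact Finset.card_biUnion_le_card_mul _ _ _ fun x _ => hCg x
    · by_cases hps : HasSmallSimplices (⋃ i, K i)ᶜ p (finrank ℝ V)
      · exact ⟨⊤, by simp, trivial, by rwa [AffineSubspace.direction_top, finrank_top]⟩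
      · obtain ⟨x, hpx, hlt⟩ := hh p hp hps
        obtain ⟨H, hH, hpH⟩ := hC x hlt p hp hpx
        exact ⟨H, Finset.mem_union_right _ (Finset.mem_biUnion.2 ⟨x, Finset.mem_univ _, hH⟩), hpH⟩

/-! ### Flat-dimension and local dimension -/

section Dimension

variable {d : ℕ} {S : Set (EuclideanSpace ℝ (Fin d))} {p q : EuclideanSpace ℝ (Fin d)}

theorem IncludesSimplex.le_flatDim {k : ℤ} (h : IncludesSimplex S k) : k ≤ flatDim S :=
  (isGreatest_flatDim S).2 h

theorem flatDim_mono {T : Set (EuclideanSpace ℝ (Fin d))} (h : S ⊆ T) :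
    flatDim S ≤ flatDim T := by
  obtain ⟨m, v, hm, hv, hvS⟩ := (isGreatest_flatDim S).1
  exact IncludesSimplex.le_flatDim ⟨m, v, hm, hv, hvS.trans h⟩

theorem flatDim_le_finrank_direction {H : AffineSubspace ℝ (EuclideanSpace ℝ (Fin d))}
    (h : S ⊆ H) : flatDim S ≤ finrank ℝ H.direction := by
  obtain ⟨m, v, hm, hv, hvS⟩ := (isGreatest_flatDim S).1
  have h1 := hv.card_le_finrank_succ
  have h2 : vectorSpan ℝ (range v) ≤ H.direction := by
    rw [← direction_affineSpan]
    exact AffineSubspace.direction_le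
      (affineSpan_le.2 ((subset_convexHull ℝ _).trans (hvS.trans h)))
  have h3 := Submodule.finrank_mono h2
  rw [Fintype.card_fin] at h1
  have h4 : (m : ℤ) ≤ finrank ℝ H.direction + 1 := by exact_mod_cast h1.trans (by gcongr)
  linarith

/-- A smaller ball about `q` fits inside; this makes local dimension upper semicontinuous. -/
theorem localDim_le_flatDim {ε : ℝ} (hq : q ∈ Metric.ball p ε) :
    localDim S q ≤ flatDim (S ∩ Metric.ball p ε) := by
  obtain ⟨δ, hδ, h⟩ := Metric.isOpen_iff.1 Metric.isOpen_ball q hq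
  exact ((isLeast_localDim S q).2 ⟨δ, hδ, rfl⟩).trans
    (flatDim_mono (inter_subset_inter_right _ h))

theorem localDim_le (S : Set (EuclideanSpace ℝ (Fin d))) (p : EuclideanSpace ℝ (Fin d)) :
    localDim S p ≤ d := by
  refine (localDim_le_flatDim (Metric.mem_ball_self one_pos)).trans ?_
  refine (flatDim_le_finrank_direction (H := ⊤) (subset_univ _)).trans ?_
  rw [AffineSubspace.direction_top, finrank_top, finrank_euclideanSpace, Fintype.card_fin]

theorem HasSmallSimplices.le_localDim {k : ℕ} (h : HasSmallSimplices S p k) :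
    (k : ℤ) ≤ localDim S p := by
  obtain ⟨ε, hε, he⟩ := (isLeast_localDim S p).1
  obtain ⟨v, hv, hvS⟩ := h _ (Metric.ball_mem_nhds p hε)
  rw [he]
  exact IncludesSimplex.le_flatDim ⟨k + 1, v, by simp, hv, hvS⟩

theorem localDim_nonneg (hp : p ∈ S) : 0 ≤ localDim S p := by
  refine HasSmallSimplices.le_localDim (k := 0) fun U hU => ?_
  have : Subsingleton (Fin (0 + 1)) := inferInstanceAs (Subsingleton (Fin 1))
  refine ⟨fun _ => p, affineIndependent_of_subsingleton ℝ _, ?_⟩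
  simpa using ⟨hp, mem_of_mem_nhds hU⟩

/-- Near a point where `S` agrees with a flat, the local dimension is that of the flat. -/
theorem localDim_eq_of_inter_eq {H : AffineSubspace ℝ (EuclideanSpace ℝ (Fin d))}
    {U : Set (EuclideanSpace ℝ (Fin d))} (hU : IsOpen U) (hSU : S ∩ U = ↑H ∩ U) (hqH : q ∈ H)
    (hqU : q ∈ U) : localDim S q = finrank ℝ H.direction := by
  apply le_antisymm
  · obtain ⟨ε, hε, hball⟩ := Metric.isOpen_iff.1 hU q hqU
    refine (localDim_le_flatDim (Metric.mem_ball_self hε)).trans (flatDim_le_finrank_direction ?_)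
    exact fun x hx => (hSU ▸ (⟨hx.1, hball hx.2⟩ : x ∈ S ∩ U) : x ∈ ↑H ∩ U).1
  · let φ : H.direction →ᵃ[ℝ] EuclideanSpace ℝ (Fin d) :=
      H.direction.subtype.toAffineMap + AffineMap.const ℝ _ q
    have hφ : ∀ w, φ w = (w : EuclideanSpace ℝ (Fin d)) + q := fun w => rfl
    have hφi : Function.Injective φ := fun a b hab => by simpa [hφ] using hab
    have hφc : Continuous φ := by
      have : Continuous fun w : H.direction => (w : EuclideanSpace ℝ (Fin d)) + q := by fun_prop
      exact this
    have h0 : φ 0 = q := by simp [hφ]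
    rw [← h0]
    refine (HasSmallSimplices.map hφi hφc (hasSmallSimplices_of_mem_nhds ?_)).le_localDim
    filter_upwards [hφc.continuousAt.preimage_mem_nhds (hU.mem_nhds (h0 ▸ hqU))] with w hw
    refine (hSU.symm ▸ (⟨?_, hw⟩ : φ w ∈ ↑H ∩ U) : φ w ∈ S ∩ U).1
    exact AffineSubspace.vadd_mem_of_mem_direction w.2 hqH

end Dimension

/-! ### Linear algebra of flats -/

theorem eq_of_le_of_finrank_direction_le {V P : Type*} [AddCommGroup V] [Module ℝ V]
    [FiniteDimensional ℝ V] [AddTorsor V P] {A B : AffineSubspace ℝ P} (hA : (A : Set P).Nonempty)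
    (hle : A ≤ B) (h : finrank ℝ B.direction ≤ finrank ℝ A.direction) : A = B :=
  AffineSubspace.eq_of_direction_eq_of_nonempty_of_le
    (Submodule.eq_of_le_of_finrank_le (AffineSubspace.direction_le hle) h) hA hle

theorem exists_submodule_ge_finrank_eq {V : Type*} [AddCommGroup V] [Module ℝ V]
    [FiniteDimensional ℝ V] (W : Submodule ℝ V) {m : ℕ} (hW : finrank ℝ W ≤ m)
    (hm : m ≤ finrank ℝ V) : ∃ W' : Submodule ℝ V, W ≤ W' ∧ finrank ℝ W' = m := by
  induction m, hW using Nat.le_induction with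
  | base => exact ⟨W, le_rfl, rfl⟩
  | succ m _ ih =>
    obtain ⟨W', hle, hW'⟩ := ih (by lia)
    have hne : W' ≠ ⊤ := by
      rintro rfl
      rw [finrank_top] at hW'
      lia
    obtain ⟨x, -, hx⟩ := SetLike.exists_of_lt hne.lt_top
    exact ⟨W' ⊔ ℝ ∙ x, hle.trans le_sup_left, by
      rw [Submodule.finrank_sup_span_singleton hx, hW']⟩

/-! ### Strong covers and ordinary flats -/

section Cover

variable {d : ℕ} {S : Set (EuclideanSpace ℝ (Fin d))}
  {C : Set (AffineSubspace ℝ (EuclideanSpace ℝ (Fin d)))}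

/-- Every ordinary flat belongs to every finite cover. -/
theorem ordinaryFlats_subset (hC : C.Finite) (hcov : IsLocalDimCover S C) :
    ordinaryFlats S ⊆ C := by
  rintro H ⟨k, -, -, p, hpS, -, ⟨-, hHk⟩, U, hU, hpU, hSU⟩
  have hpH : p ∈ H := (hSU ▸ (⟨hpS, hpU⟩ : p ∈ S ∩ U) : p ∈ ↑H ∩ U).1
  have : Nonempty H := ⟨⟨p, hpH⟩⟩
  -- Only these can serve points of `H ∩ U`, whose local dimension is that of `H`.
  let D := {H' ∈ C | finrank ℝ H'.direction = finrank ℝ H.direction}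
  by_cases hD : ∃ H' ∈ D, H ≤ H'
  · obtain ⟨H', ⟨hH'C, hdim⟩, hle⟩ := hD
    rwa [eq_of_le_of_finrank_direction_le ⟨p, hpH⟩ hle hdim.le]
  push Not at hD
  obtain ⟨x, hxU, hx⟩ := exists_mem_forall_notMem_of_ne_top
    (C := AffineSubspace.comap H.subtype '' D) ((hC.subset (sep_subset _ _)).image _)
    (by
      rintro _ ⟨H', hH', rfl⟩ htop
      refine hD H' hH' fun y hy => ?_
      have : (⟨y, hy⟩ : H) ∈ AffineSubspace.comap H.subtype H' := htop ▸ AffineSubspace.mem_top ..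
      exact this)
    (hU.preimage continuous_subtype_val) ⟨⟨p, hpH⟩, hpU⟩
  have hxS : (x : EuclideanSpace ℝ (Fin d)) ∈ S :=
    (hSU.symm ▸ (⟨x.2, hxU⟩ : ↑x ∈ ↑H ∩ U) : ↑x ∈ S ∩ U).1
  obtain ⟨H', hH'C, hxH', -, hdim⟩ := hcov.2 x hxS
  rw [localDim_eq_of_inter_eq hU hSU x.2 hxU, Nat.cast_inj] at hdim
  exact absurd hxH' (hx _ ⟨H', ⟨hH'C, hdim⟩, rfl⟩)

/-- A member of a finite cover that is the only one through some point with the local dimension of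
that point is an ordinary flat. -/
theorem mem_ordinaryFlats_of_unique (hC : C.Finite) (hcov : IsLocalDimCover S C)
    {H : AffineSubspace ℝ (EuclideanSpace ℝ (Fin d))} {p : EuclideanSpace ℝ (Fin d)} (hpS : p ∈ S)
    (huniq : ∀ H' ∈ C, p ∈ H' → IsFlatOfDim (localDim S p) H' → H' = H) :
    H ∈ ordinaryFlats S := by
  set k := localDim S p with hk
  obtain ⟨ε₀, hε₀, he₀⟩ := (isLeast_localDim S p).1
  have hfar : (⋃ H' ∈ {H' ∈ C | p ∉ H'}, (H' : Set (EuclideanSpace ℝ (Fin d))))ᶜ ∈ 𝓝 p := by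
    refine (((hC.subset (sep_subset _ _)).isClosed_biUnion
      fun H' _ => H'.closed_of_finiteDimensional).isOpen_compl).mem_nhds ?_
    simp
  obtain ⟨ε₁, hε₁, hball₁⟩ := Metric.mem_nhds_iff.1 hfar
  -- `ε₀` bounds nearby local dimensions by `k`; `ε₁` makes every member of `C` meeting the ball
  -- pass through `p`.
  let ε := min ε₀ ε₁
  have hε : 0 < ε := lt_min hε₀ hε₁
  have hdim : ∀ q ∈ Metric.ball p ε, localDim S q ≤ k := fun q hq => by
    rw [hk, he₀]
    exact localDim_le_flatDim (Metric.ball_subset_ball (min_le_left _ _) hq)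
  have hthru : ∀ q ∈ Metric.ball p ε, ∀ H' ∈ C, q ∈ H' → p ∈ H' := fun q hq H' hH' hqH' => by
    by_contra hp
    exact hball₁ (Metric.ball_subset_ball (min_le_right _ _) hq) (mem_biUnion ⟨hH', hp⟩ hqH')
  -- a `k`-simplex in `S` near `p`
  obtain ⟨m, v, hm, hv, hvS⟩ := (isGreatest_flatDim (S ∩ Metric.ball p ε)).1
  have hkm : k ≤ flatDim (S ∩ Metric.ball p ε) := (isLeast_localDim S p).2 ⟨ε, hε, rfl⟩
  have hmk : flatDim (S ∩ Metric.ball p ε) ≤ k := by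
    rw [hk, he₀]
    exact flatDim_mono (inter_subset_inter_right _ (Metric.ball_subset_ball (min_le_left _ _)))
  have hk0 : 0 ≤ k := localDim_nonneg hpS
  obtain ⟨r, rfl⟩ : ∃ r, m = r + 1 := ⟨m - 1, by lia⟩
  have hrk : (r : ℤ) = k := by push_cast at hm; lia
  let Δ := convexHull ℝ (range v)
  let A := affineSpan ℝ Δ
  have hAdim : finrank ℝ A.direction = r := by
    rw [show A = affineSpan ℝ (range v) from affineSpan_convexHull _, direction_affineSpan]
    exact hv.finrank_vectorSpan (Fintype.card_fin _)
  have hΔne : Δ.Nonempty := (range_nonempty v).convexHull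
  have : Nonempty A := (hΔne.affineSpan ℝ).to_subtype
  obtain ⟨-, x₀, hx₀, -⟩ := hΔne.intrinsicInterior (convex_convexHull ℝ _)
  -- a point of the simplex in general position with respect to the cover
  let D := {H' ∈ C | ¬ A ≤ H'}
  obtain ⟨x, hxΔ, hx⟩ := exists_mem_forall_notMem_of_ne_top
    (C := AffineSubspace.comap A.subtype '' D) ((hC.subset (sep_subset _ _)).image _)
    (by
      rintro _ ⟨H', hH', rfl⟩ htop
      refine hH'.2 fun y hy => ?_
      have : (⟨y, hy⟩ : A) ∈ AffineSubspace.comap A.subtype H' := htop ▸ AffineSubspace.mem_top ..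
      exact this)
    isOpen_interior ⟨x₀, hx₀⟩
  have hxthru : ∀ H' ∈ C, (x : EuclideanSpace ℝ (Fin d)) ∈ H' → A ≤ H' := fun H' hH' hxH' => by
    by_contra hle
    exact hx _ ⟨H', ⟨hH', hle⟩, rfl⟩ hxH'
  have hxS := hvS (interior_subset (s := ((↑) ⁻¹' Δ : Set A)) hxΔ)
  have hAeq : ∀ y ∈ S ∩ Metric.ball p ε, ∀ H' ∈ C, IsFlatOfDim (localDim S y) H' →
      A ≤ H' → A = H' := fun y hy H' hH' hfl hle => by
    refine eq_of_le_of_finrank_direction_le (hΔne.affineSpan ℝ) hle ?_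
    rw [hAdim, ← Nat.cast_le (α := ℤ), hrk]
    exact hfl.2.trans_le (hdim y hy.2)
  have hAH : A = H := by
    obtain ⟨H', hH'C, hxH', hfl⟩ := hcov.2 x hxS.1
    have hA := hAeq x hxS H' hH'C hfl (hxthru H' hH'C hxH')
    rw [hA]
    refine huniq H' hH'C (hthru x hxS.2 H' hH'C hxH') ⟨hfl.1, ?_⟩
    rw [← hA, hAdim, hrk]
  obtain ⟨O, hO, hOΔ⟩ := isOpen_induced_iff.1 (isOpen_interior (s := ((↑) ⁻¹' Δ : Set A)))
  -- Within `A`, `O` keeps points in the simplex, hence in `S`; avoiding flats that miss `x` forces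
  -- points of `S` into `A`.
  let U := O ∩ Metric.ball p ε ∩
    (⋃ H' ∈ {H' ∈ C | (x : EuclideanSpace ℝ (Fin d)) ∉ H'},
      (H' : Set (EuclideanSpace ℝ (Fin d))))ᶜ
  have hU : IsOpen U := (hO.inter Metric.isOpen_ball).inter
    ((hC.subset (sep_subset _ _)).isClosed_biUnion
      fun H' _ => H'.closed_of_finiteDimensional).isOpen_compl
  have hxU : (x : EuclideanSpace ℝ (Fin d)) ∈ U := by
    refine ⟨⟨?_, hxS.2⟩, by simp⟩
    rw [← hOΔ] at hxΔ
    exact hxΔ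
  have hSU : S ∩ U = ↑A ∩ U := by
    ext y
    refine ⟨fun ⟨hyS, hyU⟩ => ⟨?_, hyU⟩, fun ⟨hyA, hyU⟩ => ⟨?_, hyU⟩⟩
    · obtain ⟨H', hH'C, hyH', hfl⟩ := hcov.2 y hyS
      have hxH' : (x : EuclideanSpace ℝ (Fin d)) ∈ H' := by
        by_contra hxH'
        exact hyU.2 (mem_biUnion ⟨hH'C, hxH'⟩ hyH')
      have := hAeq y ⟨hyS, hyU.1.2⟩ H' hH'C hfl (hxthru H' hH'C hxH')
      rw [this]
      exact hyH'
    · have : (⟨y, hyA⟩ : A) ∈ interior ((↑) ⁻¹' Δ : Set A) := hOΔ ▸ hyU.1.1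
      exact (hvS (interior_subset (s := ((↑) ⁻¹' Δ : Set A)) this)).1
  rw [← hAH]
  refine ⟨k, hk0, localDim_le S p, x, hxS.1, ?_, ⟨hΔne.affineSpan ℝ, ?_⟩, U, hU, hxU, hSU⟩
  · rw [localDim_eq_of_inter_eq hU hSU x.2 hxU, hAdim, hrk]
  · rw [hAdim, hrk]

/-- A strong cover consists of the ordinary flats. -/
theorem IsStrongCover.eq_ordinaryFlats (h : IsStrongCover S C) : C = ordinaryFlats S := by
  obtain ⟨hC, hcov, hmin⟩ := h
  refine Subset.antisymm (fun H hH => ?_) (ordinaryFlats_subset hC hcov)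
  -- Without `H` some `p` is left unserved, so `H` alone serves it.
  have hnot := hmin (C \ {H}) (sdiff_singleton_ssubset.2 hH)
  simp only [IsLocalDimCover, not_and, not_forall, not_exists] at hnot
  obtain ⟨p, hpS, hp⟩ := hnot fun H' hH' => hcov.1 H' hH'.1
  refine mem_ordinaryFlats_of_unique hC hcov hpS fun H' hH'C hpH' hfl => ?_
  by_contra hne
  exact hp H' ⟨hH'C, hne⟩ hpH' hfl

/-- A finite cover includes a strong cover. -/
theorem IsLocalDimCover.exists_isStrongCover_subset (hC : C.Finite) (hcov : IsLocalDimCover S C) :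
    ∃ C' ⊆ C, IsStrongCover S C' := by
  have hfin : {C' | C' ⊆ C ∧ IsLocalDimCover S C'}.Finite :=
    hC.finite_subsets.subset fun C' h => h.1
  obtain ⟨C', hle, hmin⟩ := hfin.exists_le_minimal ⟨Subset.rfl, hcov⟩
  exact ⟨C', hle, hC.subset hle, hmin.prop.2, fun C'' hlt h =>
    hmin.not_prop_of_lt hlt ⟨hlt.subset.trans hle, h⟩⟩

end Cover

/-- The complement of `n` convex sets has a cover by boundedly many flats, obtained by enlarging
flats of at most the local dimension. -/
theorem exists_isLocalDimCover (n d : ℕ) :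
    ∃ g : ℕ, ∀ K : Fin n → Set (EuclideanSpace ℝ (Fin d)), (∀ i, Convex ℝ (K i)) →
      ∃ C : Finset (AffineSubspace ℝ (EuclideanSpace ℝ (Fin d))),
        C.card ≤ g ∧ IsLocalDimCover (⋃ i, K i)ᶜ (C : Set _) := by
  classical
  obtain ⟨g, hg⟩ := exists_flats_hasSmallSimplices n d
  -- Each flat may be enlarged to each dimension from `0` to `d`.
  refine ⟨g * (d + 1), fun K hK => ?_⟩
  obtain ⟨C, hCg, hC⟩ := hg (EuclideanSpace ℝ (Fin d)) (by simp) K hK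
  have hext : ∀ x : AffineSubspace ℝ (EuclideanSpace ℝ (Fin d)) × ℕ,
      ∃ H : AffineSubspace ℝ (EuclideanSpace ℝ (Fin d)), x.1 ≤ H ∧
        ((x.1 : Set (EuclideanSpace ℝ (Fin d))).Nonempty → finrank ℝ x.1.direction ≤ x.2 →
          x.2 ≤ d → finrank ℝ H.direction = x.2) := by
    rintro ⟨H, m⟩
    by_cases hH : (H : Set (EuclideanSpace ℝ (Fin d))).Nonempty ∧
      finrank ℝ H.direction ≤ m ∧ m ≤ d
    · obtain ⟨⟨q, hq⟩, hm, hmd⟩ := hH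
      obtain ⟨W, hle, hW⟩ := exists_submodule_ge_finrank_eq H.direction hm (by simpa using hmd)
      refine ⟨AffineSubspace.mk' q W, fun y hy => ?_, fun _ _ _ => ?_⟩
      · exact hle (AffineSubspace.vsub_mem_direction hy hq)
      · rw [AffineSubspace.direction_mk', hW]
    · exact ⟨H, le_rfl, fun h1 h2 h3 => absurd ⟨h1, h2, h3⟩ hH⟩
  choose e he hedim using hext
  refine ⟨((C ×ˢ Finset.range (d + 1)).image e).filter
    fun H => (H : Set (EuclideanSpace ℝ (Fin d))).Nonempty, ?_, ?_, fun p hp => ?_⟩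
  · refine (Finset.card_filter_le _ _).trans (Finset.card_image_le.trans ?_)
    rw [Finset.card_product, Finset.card_range]
    gcongr
  · intro H hH
    exact (Finset.mem_filter.1 hH).2
  · obtain ⟨H, hHC, hpH, hH⟩ := hC p hp
    obtain ⟨m, hm⟩ := Int.eq_ofNat_of_zero_le (localDim_nonneg hp)
    have h1 := hH.le_localDim
    have h2 := localDim_le (⋃ i, K i)ᶜ p
    rw [hm, Nat.cast_le] at h1 h2
    have hpe : p ∈ e (H, m) := he (H, m) hpH
    refine ⟨e (H, m), ?_, hpe, ⟨p, hpe⟩, ?_⟩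
    · refine Finset.mem_coe.2 (Finset.mem_filter.2 ⟨Finset.mem_image_of_mem _ ?_, p, hpe⟩)
      simp only [Finset.mem_product, Finset.mem_range]
      exact ⟨hHC, by lia⟩
    · rw [hm, Nat.cast_inj]
      exact hedim (H, m) ⟨p, hpH⟩ h1 h2

end FlatCover

theorem theorem3 (n d : ℕ) :
    ∃ g : ℕ, ∀ K : Fin n → Set (EuclideanSpace ℝ (Fin d)), (∀ i, Convex ℝ (K i)) →
      ∀ S : Set (EuclideanSpace ℝ (Fin d)), S = (⋃ i, K i)ᶜ →
        (∃ C : Set (AffineSubspace ℝ (EuclideanSpace ℝ (Fin d))),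
          C.encard ≤ (g : ℕ∞) ∧ FlatCover.IsLocalDimCover S C) ∧
        (∃! C : Set (AffineSubspace ℝ (EuclideanSpace ℝ (Fin d))), FlatCover.IsStrongCover S C) ∧
        FlatCover.IsStrongCover S (FlatCover.ordinaryFlats S) ∧
        (FlatCover.ordinaryFlats S).Finite ∧
        (FlatCover.ordinaryFlats S).encard ≤ (g : ℕ∞) := by
  obtain ⟨g, hg⟩ := FlatCover.exists_isLocalDimCover n d
  refine ⟨g, ?_⟩
  rintro K hK S rfl
  obtain ⟨C, hCg, hcov⟩ := hg K hK
  have hcard : (C : Set (AffineSubspace ℝ (EuclideanSpace ℝ (Fin d)))).encard ≤ (g : ℕ∞) := by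
    rw [Set.encard_coe_eq_coe_finsetCard]
    exact_mod_cast hCg
  obtain ⟨C', hsub, hstrong⟩ := hcov.exists_isStrongCover_subset C.finite_toSet
  have hord := hstrong.eq_ordinaryFlats
  subst hord
  exact ⟨⟨C, hcard, hcov⟩, ⟨_, hstrong, fun _ h => h.eq_ordinaryFlats⟩, hstrong, hstrong.1,
    (Set.encard_le_encard hsub).trans hcard⟩
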